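/- Let $K$ be a number field, $\overline{K}$ an algebraic closure of $K$, and $\sigma\in \mathrm{Gal}(\overline{K}/K)$. Let $\overline{K}^{\sigma}=\{x\in\overline{K} : \sigma(x)=x\}$ be the fixed field of $\sigma$, and give $\mathrm{Gal}(\overline{K}/\overline{K}^{\sigma})$ the Krull topology. Then, as a topological group, $$\mathrm{Gal}(\overline{K}/\overline{K}^{\sigma})\cong\prod_{p\in S}\mathbb{Z}_p \text{ for some (possibly empty) set } S \text{ of prime numbers},\quad\text{or}\quad \mathrm{Gal}(\overline{K}/\overline{K}^{\sigma})\cong\mathbb{Z}/2\mathbb{Z},$$ where $\mathbb{Z}_p$ is the additive group of $p$-adic integers, the product carries the product topology and $\mathbb{Z}/2\mathbb{Z}$ is discrete. Moreover, if $K$ is totally imaginary (it has no real embedding), then $\mathrm{Gal}(\overline{K}/\overline{K}^{\sigma})$ has no element of finite order other than the identity, and the Brauer group $\mathrm{Br}(\overline{K}^{\sigma})$ (Brauer classes of finite-dimensional central simple $\overline{K}^{\sigma}$-algebras) is trivial. -/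

import Mathlib

universe u v

namespace FixedFieldBrauer

/-- The fixed field of a single automorphism `σ` of `L` over `K`, that is `{x ∈ L | σ x = x}`. -/
abbrev fixedFieldOf {K : Type u} {L : Type v} [Field K] [Field L] [Algebra K L]
    (σ : Gal(L/K)) : IntermediateField K L :=
  IntermediateField.fixedField (Subgroup.zpowers σ)

theorem mem_fixedFieldOf {K : Type u} {L : Type v} [Field K] [Field L] [Algebra K L]
    (σ : Gal(L/K)) (x : L) : x ∈ fixedFieldOf σ ↔ σ x = x := by
  rw [IntermediateField.mem_fixedField_iff]
  constructor
  · intro h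
    exact h σ (Subgroup.mem_zpowers σ)
  · intro h f hf
    have hs : σ ∈ MulAction.stabilizer Gal(L/K) x := h
    exact (Subgroup.zpowers_le.mpr hs) hf

/-- The neutral element of the Brauer group of `F`: the Brauer class of the central simple
`F`-algebra `F`. -/
def trivialBrauerClass (F : Type v) [Field F] : BrauerGroup.{v, v} F :=
  Quotient.mk (Brauer.CSA_Setoid F) { AlgCat.of F F with }

/-- The Brauer group of `F` is trivial: every Brauer class is the class of `F`. -/
def BrauerTrivial (F : Type v) [Field F] : Prop :=
  ∀ b : BrauerGroup.{v, v} F, b = trivialBrauerClass F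

/-- The topological group `∏_{p ∈ S} ℤ_p`, written multiplicatively, with the product topology. -/
abbrev padicProduct (S : Set Nat.Primes) : Type :=
  Multiplicative (∀ p : S, haveI : Fact (p.1 : ℕ).Prime := ⟨p.1.2⟩; ℤ_[(p.1 : ℕ)])

end FixedFieldBrauer

/-! Write `F` for the fixed field of `σ` and `G` for its absolute Galois group. By infinite Galois
theory `σ` generates `G` topologically, so `G` is abelian and procyclic.

If `G` has torsion, the Artin-Schreier argument (`exists_smul_eq_neg_of_isOfFinOrder`) gives an
involution negating a square root of `-1`. The squares of its fixed elements are the nonnegative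
elements of an ordering. An automorphism with finite orbits that commutes with the involution
preserves this ordering, hence is `1` or the involution, so `G` has order two. Restricted to `K`,
the ordering is archimedean and yields a real embedding, which is excluded when `K` is totally
imaginary.

If `G` is torsion-free, compactness shows that a prime dividing the index of one open subgroup
occurs in such indices to every power (`exists_pow_dvd_index`). Let `S` be the set of these primes.
The closure of the cyclic group generated by `(σ, 1)` in the product of `G` and `∏ ℤ_p` is then the
graph of an isomorphism.

For the Brauer group, the same divisibility and Hilbert 90 make norms from finite extensions of `F`
surjective (`exists_partialNorm_eq`). In a central division algebra, a self-centralizing subfield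
`L` is cyclic over `F`, and Skolem-Noether gives `x` inducing a generator, with `x ^ n` in `F`.
Rescaling `x` by an element of suitable norm gives `y ^ n = 1`, which forces `y = 1` and `L = F`;
Wedderburn's theorem concludes. -/

open Finset

/-! ### Partial norms and Hilbert 90. -/

section PartialNorm

variable {G C : Type*} [Group G] [Field C] [MulSemiringAction G C]

/-- The partial norm `b * g(b) * ⋯ * g ^ (k - 1) (b)`. -/
def partialNorm (g : G) (k : ℕ) (b : C) : C := ∏ i ∈ range k, g ^ i • b

theorem partialNorm_succ (g : G) (k : ℕ) (b : C) :
    partialNorm g (k + 1) b = partialNorm g k b * g ^ k • b :=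
  prod_range_succ _ _

theorem smul_partialNorm (g : G) (k : ℕ) (b : C) :
    b * g • partialNorm g k b = partialNorm g (k + 1) b := by
  rw [partialNorm, partialNorm, prod_range_succ', smul_prod', mul_comm]
  simp [pow_succ', mul_smul]

theorem partialNorm_add (g : G) (k l : ℕ) (b : C) :
    partialNorm g (k + l) b = partialNorm g k b * g ^ k • partialNorm g l b := by
  rw [partialNorm, partialNorm, partialNorm, prod_range_add, smul_prod']
  simp [pow_add, mul_smul]

theorem partialNorm_mul (g : G) (k : ℕ) (b c : C) :
    partialNorm g k (b * c) = partialNorm g k b * partialNorm g k c := by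
  simp [partialNorm, prod_mul_distrib]

theorem partialNorm_inv (g : G) (k : ℕ) (b : C) :
    partialNorm g k b⁻¹ = (partialNorm g k b)⁻¹ := by
  simp [partialNorm]

theorem partialNorm_pow (g : G) (k n : ℕ) (b : C) :
    partialNorm g k (b ^ n) = partialNorm g k b ^ n := by
  simp [partialNorm, prod_pow]

theorem partialNorm_ne_zero (g : G) (k : ℕ) {b : C} (hb : b ≠ 0) : partialNorm g k b ≠ 0 :=
  prod_ne_zero_iff.mpr fun _ _ => (smul_ne_zero_iff_ne _).mpr hb

theorem partialNorm_of_smul_eq (g : G) (k : ℕ) {a : C} (ha : g • a = a) :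
    partialNorm g k a = a ^ k := by
  have h (i : ℕ) : g ^ i • a = a :=
    (MulAction.stabilizer G a).pow_mem (MulAction.mem_stabilizer_iff.mpr ha) i
  simp [partialNorm, h]

theorem partialNorm_partialNorm (g : G) (n m : ℕ) (b : C) :
    partialNorm (g ^ n) m (partialNorm g n b) = partialNorm g (n * m) b := by
  induction m with
  | zero => simp [partialNorm]
  | succ m ih => rw [partialNorm_succ, ih, Nat.mul_succ, partialNorm_add, ← pow_mul]

theorem partialNorm_mul_of_pow_smul_eq (g : G) (d q : ℕ) {b : C} (hb : g ^ d • b = b) :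
    partialNorm g (d * q) b = partialNorm g d b ^ q := by
  rw [← partialNorm_partialNorm]
  refine partialNorm_of_smul_eq _ _ ?_
  rw [partialNorm, smul_prod']
  refine prod_congr rfl fun i _ => ?_
  rw [← mul_smul, ← pow_add, add_comm, pow_add, mul_smul, hb]

/-- If the partial norm of length `k` is fixed by `g`, then the element is fixed by `g ^ k`. -/
theorem pow_smul_eq_of_smul_partialNorm_eq (g : G) (k : ℕ) {b : C} (hb : b ≠ 0)
    (h : g • partialNorm g k b = partialNorm g k b) : g ^ k • b = b := by
  have h1 := smul_partialNorm g k b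
  rw [h, partialNorm_succ, mul_comm] at h1
  exact (mul_left_cancel₀ (partialNorm_ne_zero g k hb) h1).symm

/-- **Hilbert's Theorem 90**, with the independence of characters used on a multiplicative
submonoid `M` on which `g ^ m` is trivial. -/
theorem exists_mul_smul_eq_of_partialNorm_eq_one (g : G) (m : ℕ) (hm : 0 < m) (M : Submonoid C)
    (hM : ∀ x ∈ M, g ^ m • x = x)
    (hinj : ∀ i < m, ∀ j < m, (∀ x ∈ M, g ^ i • x = g ^ j • x) → i = j)
    {u : C} (hu : partialNorm g m u = 1) : ∃ e : C, e ≠ 0 ∧ u * g • e = e := by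
  let χ : Fin m → (M →* C) := fun i =>
    { toFun := fun x => g ^ (i : ℕ) • (x : C)
      map_one' := by simp
      map_mul' := fun x y => by simp [smul_mul'] }
  have hχ : Function.Injective χ := fun i j hij => Fin.ext <| hinj i i.2 j j.2 fun x hx =>
    DFunLike.congr_fun hij ⟨x, hx⟩
  have hli := (linearIndependent_monoidHom M C).comp χ hχ
  rw [Fintype.linearIndependent_iff] at hli
  -- A nonzero Lagrange resolvent: applying `g` and multiplying by `u` shifts its terms cyclically,
  -- the last one returning to `c`.
  obtain ⟨c, hc⟩ : ∃ c : M, ∑ i : Fin m, partialNorm g i u * g ^ (i : ℕ) • (c : C) ≠ 0 := by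
    by_contra! h
    have := hli (fun i => partialNorm g i u) (by
      ext c
      simpa [χ] using h c) ⟨0, hm⟩
    simp [partialNorm] at this
  refine ⟨_, hc, ?_⟩
  rw [Fin.sum_univ_eq_sum_range (fun i => partialNorm g i u * g ^ i • (c : C)), smul_sum, mul_sum]
  have key : ∀ i, u * g • (partialNorm g i u * g ^ i • (c : C)) =
      partialNorm g (i + 1) u * g ^ (i + 1) • (c : C) := fun i => by
    rw [smul_mul', ← mul_assoc, smul_partialNorm, ← mul_smul, ← pow_succ']
  simp_rw [key]
  obtain ⟨m, rfl⟩ := Nat.exists_eq_succ_of_ne_zero hm.ne'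
  rw [sum_range_succ, hu, hM _ c.2, sum_range_succ' (fun i => partialNorm g i u * g ^ i • (c : C))]
  simp [partialNorm]

end PartialNorm

/-! ### Automorphisms of finite order of an algebraically closed field. -/

section ArtinSchreier

variable {G C : Type*} [Group G] [Field C] [MulSemiringAction G C]

/-- An automorphism of prime order `p` of an algebraically closed field of characteristic zero
fixes the `p`-th roots of unity. -/
theorem smul_eq_of_pow_prime_eq_one {p : ℕ} (hp : p.Prime) {g : G} (hg : g ^ p = 1)
    {ζ : C} (hζ : IsPrimitiveRoot ζ p) : g • ζ = ζ := by
  have : NeZero p := ⟨hp.ne_zero⟩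
  obtain ⟨j, -, hj⟩ := hζ.eq_pow_of_pow_eq_one (ξ := g • ζ) (by
    rw [← smul_pow', hζ.pow_eq_one, smul_one])
  have hpow (k : ℕ) : g ^ k • ζ = ζ ^ j ^ k := by
    induction k with
    | zero => simp
    | succ k ih => rw [pow_succ', mul_smul, ih, smul_pow', ← hj, ← pow_mul, pow_succ']
  have h1 := hpow p
  rw [hg, one_smul] at h1
  have : Fact p.Prime := ⟨hp⟩
  have h2 : j ^ p ≡ 1 [MOD p] := by
    rw [hζ.eq_orderOf, ← (hζ.isOfFinOrder hp.ne_zero).pow_eq_pow_iff_modEq, ← hζ.eq_orderOf]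
    simpa using h1.symm
  have h3 : j ^ p ≡ j [MOD p] := by
    rw [← ZMod.natCast_eq_natCast_iff]
    push_cast
    exact ZMod.pow_card _
  have h4 : j ≡ 1 [MOD p] := h3.symm.trans h2
  rw [← hj]
  rw [hζ.eq_orderOf, ← (hζ.isOfFinOrder hp.ne_zero).pow_eq_pow_iff_modEq, pow_one] at h4
  exact h4

variable [CharZero C] [IsAlgClosed C] [FaithfulSMul G C]

/-- Hilbert 90 gives `α` with `g • α = ζ * α`. If `β ^ p = α`, the norm of `β` is fixed by `g` and
its `p`-th power is the norm of `α`, so `ι` is that norm divided by `α`. For odd `p` this makes `ι`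
a `p`-th root of unity moved by `g`, which is absurd; for `p = 2` it is a square root of `-1`. -/
theorem exists_smul_ne_and_pow_eq {p : ℕ} (hp : p.Prime) {g : G} (hg : orderOf g = p) :
    ∃ ι ω : C, g • ι ≠ ι ∧ ω ^ p = 1 ∧ ι ^ p = ω ^ (p * (p - 1) / 2) ∧ g • ι = ω⁻¹ * ι ∧
      IsPrimitiveRoot ω p := by
  have hgp : g ^ p = 1 := hg ▸ pow_orderOf_eq_one g
  have : NeZero (p : C) := ⟨Nat.cast_ne_zero.mpr hp.ne_zero⟩
  obtain ⟨ζ, hζ⟩ := HasEnoughRootsOfUnity.exists_primitiveRoot C p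
  have hgζ := smul_eq_of_pow_prime_eq_one hp hgp hζ
  have hζ0 : ζ ≠ 0 := hζ.ne_zero hp.ne_zero
  obtain ⟨α, hα0, hα⟩ := exists_mul_smul_eq_of_partialNorm_eq_one g p hp.pos (⊤ : Submonoid C)
    (fun x _ => by rw [hgp, one_smul])
    (fun i hi j hj h => pow_injOn_Iio_orderOf (by simpa [hg] using hi) (by simpa [hg] using hj)
      (FaithfulSMul.eq_of_smul_eq_smul (α := C) fun x => h x trivial))
    (u := ζ⁻¹) (by rw [partialNorm_inv, partialNorm_of_smul_eq _ _ hgζ, hζ.pow_eq_one, inv_one])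
  have hα' : g • α = ζ * α := by
    rw [inv_mul_eq_iff_eq_mul₀ hζ0] at hα
    exact hα
  obtain ⟨β, hβ⟩ := IsAlgClosed.exists_pow_nat_eq α hp.pos
  have hβ0 : β ≠ 0 := by
    rintro rfl
    rw [zero_pow hp.ne_zero] at hβ
    exact hα0 hβ.symm
  have hN : g • partialNorm g p β = partialNorm g p β := by
    have h := smul_partialNorm g p β
    rw [partialNorm_succ, hgp, one_smul, mul_comm] at h
    exact mul_right_cancel₀ hβ0 h
  have hpowα (i : ℕ) : g ^ i • α = ζ ^ i * α := by
    induction i with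
    | zero => simp
    | succ i ih =>
      rw [pow_succ', mul_smul, ih, smul_mul', smul_pow', hgζ, hα', pow_succ]
      ring
  have hNα : partialNorm g p α = ζ ^ (p * (p - 1) / 2) * α ^ p := by
    simp only [partialNorm, hpowα, prod_mul_distrib, prod_const, card_range]
    rw [prod_pow_eq_pow_sum (range p) (fun i => i) ζ, sum_range_id]
  have h1 : g • (partialNorm g p β / α) = ζ⁻¹ * (partialNorm g p β / α) := by
    rw [div_eq_mul_inv, smul_mul', smul_inv'', hN, hα', mul_inv]
    ring
  have h0 : partialNorm g p β / α ≠ 0 := div_ne_zero (partialNorm_ne_zero g p hβ0) hα0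
  refine ⟨partialNorm g p β / α, ζ, ?_, hζ.pow_eq_one, ?_, h1, hζ⟩
  · rw [h1]
    intro h
    have := mul_right_cancel₀ h0 (h.trans (one_mul _).symm)
    exact hζ.ne_one hp.one_lt (inv_eq_one.mp this)
  · rw [div_pow, ← partialNorm_pow, hβ, hNα, mul_div_cancel_right₀ _ (pow_ne_zero _ hα0)]

/-- The prime order case of the **Artin-Schreier theorem**. -/
theorem eq_two_of_orderOf_eq_prime {p : ℕ} (hp : p.Prime) {g : G} (hg : orderOf g = p) :
    p = 2 ∧ ∃ i : C, i ^ 2 = -1 ∧ g • i = -i := by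
  obtain ⟨ι, ω, hne, hω, hι, hgι, hprim⟩ := exists_smul_ne_and_pow_eq (C := C) hp hg
  rcases hp.eq_two_or_odd' with rfl | hodd
  · have h1 : ω = -1 := IsPrimitiveRoot.eq_neg_one_of_two_right hprim
    subst h1
    refine ⟨rfl, ι, by simpa using hι, ?_⟩
    rw [hgι]
    norm_num
  · exfalso
    apply hne
    obtain ⟨k, hk⟩ := hodd
    have h2 : p * (p - 1) / 2 = p * k := by
      rw [hk, Nat.add_sub_cancel]
      apply Nat.div_eq_of_eq_mul_left two_pos
      ring
    rw [h2, pow_mul, hω, one_pow] at hι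
    have : NeZero p := ⟨hp.ne_zero⟩
    obtain ⟨j, -, hj⟩ := hprim.eq_pow_of_pow_eq_one hι
    rw [← hj, smul_pow',
      smul_eq_of_pow_prime_eq_one hp (hg ▸ pow_orderOf_eq_one g) hprim]

/-- The **Artin-Schreier theorem** in characteristic zero: an automorphism of finite order of an
algebraically closed field is an involution that negates a square root of `-1`. -/
theorem exists_smul_eq_neg_of_isOfFinOrder {g : G} (hfin : IsOfFinOrder g) (hg : g ≠ 1) :
    g ^ 2 = 1 ∧ ∃ i : C, i ^ 2 = -1 ∧ g • i = -i := by
  have hpos := hfin.orderOf_pos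
  have hprime (p : ℕ) (hp : p.Prime) (hd : p ∣ orderOf g) : p = 2 :=
    (eq_two_of_orderOf_eq_prime (C := C) hp
      (orderOf_pow_orderOf_div hpos.ne' hd)).1
  have hfour : ¬ 4 ∣ orderOf g := by
    intro h4
    obtain ⟨k, hk⟩ := h4
    have h2 : orderOf (g ^ (2 * k)) = 2 := by
      have := orderOf_pow_orderOf_div hpos.ne' (show 2 ∣ orderOf g from ⟨2 * k, by omega⟩)
      rwa [show orderOf g / 2 = 2 * k by omega] at this
    obtain ⟨-, i, hi, hgi⟩ := eq_two_of_orderOf_eq_prime (C := C) Nat.prime_two h2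
    -- `g ^ k` sends `i` to `±i`, so its square fixes `i`, whereas an element of order two must
    -- negate it.
    have h3 : (g ^ k • i) ^ 2 = i ^ 2 := by rw [← smul_pow', hi, smul_neg, smul_one]
    have h5 : g ^ (2 * k) • i = i := by
      rw [two_mul, pow_add, mul_smul]
      rcases sq_eq_sq_iff_eq_or_eq_neg.mp h3 with h | h
      · rw [h, h]
      · rw [h, smul_neg, h, neg_neg]
    have h6 : i = 0 := by
      rw [h5] at hgi
      exact self_eq_neg.mp hgi
    simp [h6] at hi
  have h2 : orderOf g = 2 := by
    obtain ⟨k, hk⟩ := (Nat.dvd_prime_pow Nat.prime_two).mp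
      (show orderOf g ∣ 2 ^ (orderOf g).primeFactorsList.length by
        conv_lhs => rw [← Nat.prod_primeFactorsList hpos.ne']
        rw [List.prod_eq_pow_card _ 2 fun p hp =>
          hprime p (Nat.prime_of_mem_primeFactorsList hp) (Nat.dvd_of_mem_primeFactorsList hp)])
    rcases hk with ⟨-, hk⟩
    match k, hk with
    | 0, hk => exact absurd (orderOf_eq_one_iff.mp hk) hg
    | 1, hk => exact hk
    | k + 2, hk => exact absurd ⟨2 ^ k, by rw [hk]; ring⟩ hfour
  exact ⟨h2 ▸ pow_orderOf_eq_one g, (eq_two_of_orderOf_eq_prime Nat.prime_two h2).2⟩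

end ArtinSchreier

/-! ### The ordering attached to a complex conjugation. -/

section Involution

variable {G C : Type*} [Group G] [Field C] [MulSemiringAction G C] {g : G}

/-- `x` is the square of an element fixed by `g`. -/
def IsFixedSquare (g : G) (x : C) : Prop := ∃ w : C, g • w = w ∧ w ^ 2 = x

theorem IsFixedSquare.mul {x y : C} (hx : IsFixedSquare g x) (hy : IsFixedSquare g y) :
    IsFixedSquare g (x * y) := by
  obtain ⟨w, hw, rfl⟩ := hx
  obtain ⟨z, hz, rfl⟩ := hy
  exact ⟨w * z, by rw [smul_mul', hw, hz], mul_pow _ _ _⟩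

/-- `w² + z²` is the norm of `w + z i`; writing `w + z i = t²` makes it the square of the norm of
`t`. -/
theorem IsFixedSquare.add [IsAlgClosed C] {i : C} (h2 : g ^ 2 = 1) (hi : i ^ 2 = -1)
    (hgi : g • i = -i) {x y : C}
    (hx : IsFixedSquare g x) (hy : IsFixedSquare g y) : IsFixedSquare g (x + y) := by
  obtain ⟨w, hw, rfl⟩ := hx
  obtain ⟨z, hz, rfl⟩ := hy
  obtain ⟨t, ht⟩ := IsAlgClosed.exists_pow_nat_eq (w + z * i) two_pos
  refine ⟨t * g • t, ?_, ?_⟩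
  · rw [smul_mul', ← mul_smul, ← sq, h2, one_smul, mul_comm]
  · rw [mul_pow, ← smul_pow', ht, smul_add, smul_mul', hw, hz, hgi]
    linear_combination -z ^ 2 * hi

/-- Otherwise `i` would be, up to sign, a quotient of fixed elements. -/
theorem IsFixedSquare.eq_zero_of_neg [CharZero C] {i : C} (hi : i ^ 2 = -1)
    (hgi : g • i = -i) {x : C}
    (hx : IsFixedSquare g x) (hy : IsFixedSquare g (-x)) : x = 0 := by
  obtain ⟨w, hw, rfl⟩ := hx
  obtain ⟨z, hz, hzw⟩ := hy
  by_contra hw0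
  have hw0 : w ≠ 0 := fun h => hw0 (by simp [h])
  have h1 : (z / w) ^ 2 = i ^ 2 := by
    rw [div_pow, hzw, hi, neg_div, div_self (pow_ne_zero _ hw0)]
  have h2 : g • (z / w) = z / w := by rw [div_eq_mul_inv, smul_mul', smul_inv'', hz, hw]
  have h3 : i = 0 := by
    rcases sq_eq_sq_iff_eq_or_eq_neg.mp h1 with h | h
    · rw [h, hgi] at h2
      exact neg_eq_self.mp h2
    · rw [h, smul_neg, hgi, neg_neg] at h2
      exact self_eq_neg.mp h2
  simp [h3] at hi

theorem isFixedSquare_or_neg [IsAlgClosed C] {i : C} (hi : i ^ 2 = -1) (hgi : g • i = -i) {x : C}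
    (hx : g • x = x) : IsFixedSquare g x ∨ IsFixedSquare g (-x) := by
  obtain ⟨w, rfl⟩ := IsAlgClosed.exists_pow_nat_eq x two_pos
  rw [smul_pow'] at hx
  rcases sq_eq_sq_iff_eq_or_eq_neg.mp hx with h | h
  · exact Or.inl ⟨w, h, rfl⟩
  · refine Or.inr ⟨i * w, by rw [smul_mul', hgi, h, neg_mul_neg], ?_⟩
    rw [mul_pow, hi, neg_one_mul]

theorem IsFixedSquare.smul_of_comm {h : G} (hgh : Commute g h) {x : C} (hx : IsFixedSquare g x) :
    IsFixedSquare g (h • x) := by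
  obtain ⟨w, hw, rfl⟩ := hx
  exact ⟨h • w, by rw [← mul_smul, hgh.eq, mul_smul, hw], (smul_pow' _ _ _).symm⟩

/-- An automorphism with finite orbits that commutes with a complex conjugation `g` is trivial on
the fixed field of `g`. -/
theorem smul_eq_of_commute_of_smul_eq [CharZero C] [IsAlgClosed C] {i : C}
    (h2 : g ^ 2 = 1) (hi : i ^ 2 = -1) (hgi : g • i = -i)
    {h : G} (hgh : Commute g h) (horb : ∀ x : C, ∃ n : ℕ, 0 < n ∧ h ^ n • x = x) {x : C}
    (hx : g • x = x) : h • x = x := by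
  -- Reading squares as nonnegative, `h` is monotone, so `y ≤ h y ≤ h² y ≤ ⋯ ≤ hⁿ y = y` forces
  -- equality.
  have aux : ∀ y : C, g • y = y → IsFixedSquare g (h • y - y) → h • y = y := by
    intro y hy hsq
    obtain ⟨n, hn, hny⟩ := horb y
    have hsum (k : ℕ) : IsFixedSquare g (h ^ (k + 1) • y - h • y) := by
      induction k with
      | zero => exact ⟨0, by simp⟩
      | succ k ih =>
        have h1 := (hsq.smul_of_comm (hgh.pow_right (k + 1))).add h2 hi hgi ih
        rw [smul_sub, ← mul_smul, ← pow_succ] at h1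
        convert h1 using 1
        ring
    have h3 := hsum (n - 1)
    rw [Nat.sub_add_cancel hn, hny, ← neg_sub] at h3
    exact sub_eq_zero.mp (hsq.eq_zero_of_neg hi hgi h3)
  have hfix : g • (h • x - x) = h • x - x := by
    rw [smul_sub, ← mul_smul, hgh.eq, mul_smul, hx]
  rcases isFixedSquare_or_neg hi hgi hfix with hsq | hsq
  · exact aux x hx hsq
  · have := aux (-x) (by rw [smul_neg, hx]) (by
      convert hsq using 1
      rw [smul_neg]
      ring)
    rw [smul_neg] at this
    exact neg_injective this

/-- Complex conjugations are self-centralizing among automorphisms with finite orbits. -/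
theorem eq_one_or_eq_of_commute [CharZero C] [IsAlgClosed C] [FaithfulSMul G C] {i : C}
    (h2 : g ^ 2 = 1) (hi : i ^ 2 = -1)
    (hgi : g • i = -i) {h : G} (hgh : Commute g h)
    (horb : ∀ x : C, ∃ n : ℕ, 0 < n ∧ h ^ n • x = x) : h = 1 ∨ h = g := by
  have hfix : ∀ x : C, g • x = x → h • x = x := fun x hx =>
    smul_eq_of_commute_of_smul_eq h2 hi hgi hgh horb hx
  have hgg (x : C) : g • g • x = x := by rw [← mul_smul, ← sq, h2, one_smul]
  have hdec (x : C) : ∃ a b : C, g • a = a ∧ g • b = b ∧ x = a + b * i := by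
    refine ⟨(x + g • x) / 2, (g • x - x) * i / 2, ?_, ?_, ?_⟩
    · have : g • (2 : C) = 2 := by rw [← one_add_one_eq_two, smul_add, smul_one]
      rw [div_eq_mul_inv, smul_mul', smul_inv'', this, smul_add, hgg, add_comm]
    · have : g • (2 : C) = 2 := by rw [← one_add_one_eq_two, smul_add, smul_one]
      rw [div_eq_mul_inv, smul_mul', smul_inv'', this, smul_mul', smul_sub, hgg, hgi]
      ring
    · linear_combination -((g • x - x) / 2) * hi
  have hhi : (h • i) ^ 2 = i ^ 2 := by rw [← smul_pow', hi, smul_neg, smul_one]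
  rcases sq_eq_sq_iff_eq_or_eq_neg.mp hhi with h' | h'
  · left
    refine FaithfulSMul.eq_of_smul_eq_smul (α := C) fun x => ?_
    obtain ⟨a, b, ha, hb, rfl⟩ := hdec x
    rw [smul_add, smul_mul', hfix a ha, hfix b hb, h', one_smul]
  · right
    refine FaithfulSMul.eq_of_smul_eq_smul (α := C) fun x => ?_
    obtain ⟨a, b, ha, hb, rfl⟩ := hdec x
    rw [smul_add, smul_mul', hfix a ha, hfix b hb, h', smul_add, smul_mul', ha, hb, hgi]

end Involution

/-! ### From a complex conjugation to a real embedding. -/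

section RealEmbedding

/-- An ordered field that is algebraic over `ℚ` is archimedean. -/
theorem archimedean_of_isAlgebraic_rat (K : Type*) [Field K] [LinearOrder K]
    [IsStrictOrderedRing K] [Algebra ℚ K] [Algebra.IsAlgebraic ℚ K] : Archimedean K := by
  rw [archimedean_iff_rat_le]
  intro x
  rcases le_or_gt x 1 with hx | hx
  · exact ⟨1, by simpa using hx⟩
  set f := minpoly ℚ x
  have hf : f.Monic := minpoly.monic (Algebra.IsIntegral.isIntegral x)
  have hroot : Polynomial.aeval x f = 0 := minpoly.aeval ℚ x
  have hdeg : 0 < f.natDegree := minpoly.natDegree_pos (Algebra.IsIntegral.isIntegral x)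
  obtain ⟨n, hn⟩ := Nat.exists_eq_succ_of_ne_zero hdeg.ne'
  refine ⟨∑ i ∈ range (n + 1), |f.coeff i|, ?_⟩
  rw [Polynomial.aeval_eq_sum_range, hn, sum_range_succ, ← Nat.succ_eq_add_one, ← hn,
    hf.coeff_natDegree, one_smul, hn] at hroot
  have h0 : 0 < x := one_pos.trans hx
  -- The leading term equals minus the lower ones, and `x > 1` bounds each lower power by `x ^ n`.
  have h1 : x * x ^ n ≤ (∑ i ∈ range (n + 1), |f.coeff i| : ℚ) * x ^ n := by
    rw [← pow_succ', eq_neg_of_add_eq_zero_right hroot, ← sum_neg_distrib]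
    push_cast
    rw [sum_mul]
    refine sum_le_sum fun i hi => ?_
    rw [Algebra.smul_def, eq_ratCast, ← neg_mul]
    have hi' : i ≤ n := by simpa [Nat.lt_succ_iff] using hi
    exact mul_le_mul (neg_le_abs _) (pow_le_pow_right₀ hx.le hi') (by positivity) (by positivity)
  exact le_of_mul_le_mul_right h1 (by positivity)

/-- A field algebraic over `ℚ` that is fixed by a complex conjugation of an algebraically closed
field has a real embedding. -/
theorem nonempty_ringHom_real {G C : Type*} [Group G] [Field C] [MulSemiringAction G C]
    [CharZero C] [IsAlgClosed C] {g : G} {i : C} (h2 : g ^ 2 = 1) (hi : i ^ 2 = -1)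
    (hgi : g • i = -i) {K : Type*} [Field K] [Algebra ℚ K] [Algebra.IsAlgebraic ℚ K]
    (φ : K →+* C) (hφ : ∀ x, g • φ x = φ x) : Nonempty (K →+* ℝ) := by
  classical
  let P : RingCone K :=
    { carrier := {x | IsFixedSquare g (φ x)}
      mul_mem' := fun {a b} ha hb => by
        simpa using IsFixedSquare.mul ha hb
      one_mem' := ⟨1, by simp⟩
      add_mem' := fun {a b} ha hb => by
        simpa using IsFixedSquare.add h2 hi hgi ha hb
      zero_mem' := ⟨0, by simp⟩
      eq_zero_of_mem_of_neg_mem' := fun {a} ha hb => by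
        have hb' : IsFixedSquare g (-φ a) := by simpa using hb
        exact (map_eq_zero φ).mp (IsFixedSquare.eq_zero_of_neg hi hgi ha hb') }
  have : HasMemOrNegMem P := ⟨fun a => by
    have := isFixedSquare_or_neg hi hgi (hφ a)
    rw [← map_neg] at this
    exact this⟩
  let : LinearOrder K := LinearOrder.mkOfAddGroupCone P
  have : IsOrderedRing K := IsOrderedRing.mkOfCone P
  have : IsStrictOrderedRing K := IsOrderedRing.toIsStrictOrderedRing K
  have := archimedean_of_isAlgebraic_rat K
  obtain ⟨f⟩ := Real.nonemptyOrderRingHom K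
  exact ⟨f.toRingHom⟩

end RealEmbedding

/-! ### Indices of open subgroups in procyclic groups. -/

section Procyclic

variable {G : Type*} [CommGroup G] [TopologicalSpace G] [IsTopologicalGroup G] {g : G}

theorem exists_zpow_div_mem (hg : Dense (Subgroup.zpowers g : Set G)) {U : Subgroup G}
    (hU : IsOpen (U : Set G)) (x : G) : ∃ k : ℤ, x⁻¹ * g ^ k ∈ U := by
  have hopen : IsOpen {y : G | x⁻¹ * y ∈ U} := hU.preimage (continuous_const_mul x⁻¹)
  obtain ⟨y, hyk, hy⟩ := hg.exists_mem_open hopen ⟨x, by simp [U.one_mem]⟩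
  obtain ⟨k, rfl⟩ := Subgroup.mem_zpowers_iff.mp hyk
  exact ⟨k, hy⟩

theorem zpow_mem_iff_index_dvd (hg : Dense (Subgroup.zpowers g : Set G)) {U : Subgroup G}
    (hU : IsOpen (U : Set G)) (k : ℤ) : g ^ k ∈ U ↔ (U.index : ℤ) ∣ k := by
  have hgen : ∀ x : G ⧸ U, x ∈ Subgroup.zpowers (g : G ⧸ U) := by
    intro x
    obtain ⟨x, rfl⟩ := QuotientGroup.mk_surjective x
    obtain ⟨k, hk⟩ := exists_zpow_div_mem hg hU x
    refine Subgroup.mem_zpowers_iff.mpr ⟨k, ?_⟩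
    rw [← QuotientGroup.mk_zpow]
    exact (QuotientGroup.eq.mpr hk).symm
  rw [Subgroup.index, ← orderOf_eq_card_of_forall_mem_zpowers hgen, orderOf_dvd_iff_zpow_eq_one,
    ← QuotientGroup.mk_zpow, QuotientGroup.eq_one_iff]

theorem pow_mem_iff_index_dvd (hg : Dense (Subgroup.zpowers g : Set G)) {U : Subgroup G}
    (hU : IsOpen (U : Set G)) (k : ℕ) : g ^ k ∈ U ↔ U.index ∣ k := by
  rw [← zpow_natCast, zpow_mem_iff_index_dvd hg hU, Int.natCast_dvd_natCast]

variable [CompactSpace G]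

theorem index_pos_of_isOpen {U : Subgroup G} (hU : IsOpen (U : Set G)) : 0 < U.index := by
  have := Subgroup.quotient_finite_of_isOpen U hU
  have := Subgroup.finiteIndex_of_finite_quotient (H := U)
  exact Nat.pos_of_ne_zero Subgroup.FiniteIndex.index_ne_zero

variable [TotallyDisconnectedSpace G]

theorem eq_one_of_forall_mem_isOpen [T2Space G] {x : G}
    (hx : ∀ U : Subgroup G, IsOpen (U : Set G) → x ∈ U) : x = 1 := by
  by_contra hne
  obtain ⟨H, hH⟩ := ProfiniteGrp.exist_openNormalSubgroup_sub_open_nhds_of_one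
    (isOpen_compl_singleton (x := x)) (by simpa using Ne.symm hne)
  exact hH (hx H.toSubgroup H.isOpen') rfl

/-- In a torsion-free procyclic profinite group, if a prime divides the index of an open subgroup
then all its powers do so. -/
theorem exists_pow_dvd_index [T2Space G] (hg : Dense (Subgroup.zpowers g : Set G))
    (htf : ∀ x : G, IsOfFinOrder x → x = 1) {p : ℕ} (hp : p.Prime) {U₀ : Subgroup G}
    (hU₀ : IsOpen (U₀ : Set G)) (hd : p ∣ U₀.index) (k : ℕ) :
    ∃ U : Subgroup G, IsOpen (U : Set G) ∧ p ^ k ∣ U.index := by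
  by_contra! hno
  -- A point common to all `Z U` would be a nontrivial element killed by `p ^ k`.
  let Z : {U : Subgroup G // IsOpen (U : Set G)} → Set G :=
    fun U => {x | x ^ p ^ k ∈ U.1} ∩ (U₀ : Set G)ᶜ
  have hclosed : ∀ U, IsClosed (Z U) := fun U =>
    ((U.1.isClosed_of_isOpen U.2).preimage (continuous_pow _)).inter hU₀.isClosed_compl
  have hne : ∀ U, (Z U).Nonempty := by
    intro U
    set V := U.1 ⊓ U₀
    have hV : IsOpen (V : Set G) := U.2.inter hU₀
    obtain ⟨e, m, hm, hem⟩ := Nat.exists_eq_pow_mul_and_not_dvd (index_pos_of_isOpen hV).ne' p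
      hp.ne_one
    have hek : e < k := by
      by_contra! hke
      exact hno V hV ((pow_dvd_pow p hke).trans ⟨m, hem⟩)
    -- With `m` the prime-to-`p` part of the index of `V`, that index divides `m * p ^ k`, while the
    -- index of `U₀`, a multiple of `p`, does not divide `m`.
    refine ⟨g ^ m, ?_, fun h => ?_⟩
    · have : g ^ (m * p ^ k) ∈ V := by
        rw [pow_mem_iff_index_dvd hg hV, hem, mul_comm]
        exact Nat.mul_dvd_mul_left _ (pow_dvd_pow p hek.le)
      rw [pow_mul] at this
      exact this.1
    · exact hm (hd.trans ((pow_mem_iff_index_dvd hg hU₀ m).mp h))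
  have : Nonempty {U : Subgroup G // IsOpen (U : Set G)} := ⟨⟨U₀, hU₀⟩⟩
  obtain ⟨x, hx⟩ := IsCompact.nonempty_iInter_of_directed_nonempty_isCompact_isClosed Z
    (fun U V => ⟨⟨U.1 ⊓ V.1, U.2.inter V.2⟩, fun x hx => ⟨hx.1.1, hx.2⟩,
      fun x hx => ⟨hx.1.2, hx.2⟩⟩) hne (fun U => (hclosed U).isCompact) hclosed
  rw [Set.mem_iInter] at hx
  have h1 : x ^ p ^ k = 1 := eq_one_of_forall_mem_isOpen fun U hU => (hx ⟨U, hU⟩).1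
  have h2 : x = 1 := htf x (isOfFinOrder_iff_pow_eq_one.mpr ⟨_, pow_pos hp.pos k, h1⟩)
  exact (hx ⟨U₀, hU₀⟩).2 (h2 ▸ U₀.one_mem)

/-- This supplies the larger extension in which the norm computation of `exists_partialNorm_eq`
takes place. Each prime factor of `n` is gained by intersecting with an open subgroup whose index
has a higher power of that prime. -/
theorem exists_le_mul_dvd_index [T2Space G] (hg : Dense (Subgroup.zpowers g : Set G))
    (htf : ∀ x : G, IsOfFinOrder x → x = 1) {U₀ : Subgroup G} (hU₀ : IsOpen (U₀ : Set G))
    (n : ℕ) (hn : n ≠ 0) (hd : n ∣ U₀.index) :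
    ∃ V : Subgroup G, IsOpen (V : Set G) ∧ V ≤ U₀ ∧ U₀.index * n ∣ V.index := by
  induction n using induction_on_primes with
  | zero => exact absurd rfl hn
  | one => exact ⟨U₀, hU₀, le_rfl, by simp⟩
  | prime_mul p n hp ih =>
    obtain ⟨V, hV, hVU, hVd⟩ := ih (right_ne_zero_of_mul hn) ((dvd_mul_left n p).trans hd)
    obtain ⟨e, m, hm, hem⟩ := Nat.exists_eq_pow_mul_and_not_dvd (index_pos_of_isOpen hV).ne' p
      hp.ne_one
    obtain ⟨W, hW, hWd⟩ := exists_pow_dvd_index hg htf hp hU₀ ((dvd_mul_right p n).trans hd) (e + 1)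
    refine ⟨V ⊓ W, hV.inter hW, inf_le_left.trans hVU, ?_⟩
    have h1 : U₀.index * (p * n) ∣ p * V.index := by
      rw [mul_left_comm]
      exact mul_dvd_mul_left p hVd
    refine h1.trans ?_
    have h2 : p * V.index = p ^ (e + 1) * m := by rw [hem, pow_succ]; ring
    rw [h2]
    refine Nat.Coprime.mul_dvd_of_dvd_of_dvd
      (Nat.Coprime.pow_left _ ((Nat.Prime.coprime_iff_not_dvd hp).mpr hm))
      (hWd.trans (Subgroup.index_dvd_of_le inf_le_right)) ?_
    exact (Dvd.intro_left _ hem.symm).trans (Subgroup.index_dvd_of_le inf_le_left)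

end Procyclic

/-! ### Torsion-free procyclic groups as products of `ℤ_p`. -/

section PadicProduct

open FixedFieldBrauer

local instance (p : Nat.Primes) : Fact (p : ℕ).Prime := ⟨p.2⟩

/-- The element of `∏ ℤ_p` with all components `1`, a topological generator. -/
noncomputable def padicGenerator (S : Set Nat.Primes) : padicProduct S := Multiplicative.ofAdd 1

theorem toAdd_padicGenerator_zpow (S : Set Nat.Primes) (m : ℤ) (p : S) :
    Multiplicative.toAdd (padicGenerator S ^ m) p = (m : ℤ_[(p.1 : ℕ)]) := by
  rw [padicGenerator, ← ofAdd_zsmul, toAdd_ofAdd, Pi.smul_apply, Pi.one_apply, zsmul_one]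

/-- A basic neighbourhood constrains finitely many coordinates, each modulo a prime power, so the
Chinese remainder theorem provides the exponent. -/
theorem dense_zpowers_padicGenerator (S : Set Nat.Primes) :
    Dense (Subgroup.zpowers (padicGenerator S) : Set (padicProduct S)) := by
  intro x
  rw [mem_closure_iff_nhds]
  intro t ht
  have ht' : Multiplicative.ofAdd ⁻¹' t ∈ nhds (Multiplicative.toAdd x) := ht
  rw [nhds_pi, Filter.mem_pi] at ht'
  obtain ⟨I, hI, s, hs, hst⟩ := ht'
  have hball : ∀ p : S, ∃ k : ℕ, ∀ y : ℤ_[(p.1 : ℕ)],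
      Multiplicative.toAdd x p - y ∈ Ideal.span {((p.1 : ℕ) : ℤ_[(p.1 : ℕ)]) ^ k} → y ∈ s p := by
    intro p
    obtain ⟨ε, hε, hεs⟩ := Metric.mem_nhds_iff.mp (hs p)
    obtain ⟨k, hk⟩ := PadicInt.exists_pow_neg_lt (p.1 : ℕ) hε
    refine ⟨k, fun y hy => hεs ?_⟩
    rw [Metric.mem_ball, dist_comm, dist_eq_norm]
    exact ((PadicInt.norm_le_pow_iff_mem_span_pow _ _).mpr hy).trans_lt hk
  choose k hk using hball
  obtain ⟨m, hm⟩ := Nat.chineseRemainderOfFinset (fun p : S => (Multiplicative.toAdd x p).appr (k p))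
    (fun p : S => (p.1 : ℕ) ^ k p) hI.toFinset (fun p _ => pow_ne_zero _ p.1.2.ne_zero)
    (fun p _ q _ hpq => Nat.Coprime.pow _ _ ((Nat.coprime_primes p.1.2 q.1.2).mpr
      fun h => hpq (Subtype.ext (Nat.Primes.coe_nat_injective h))))
  refine ⟨padicGenerator S ^ (m : ℤ), ?_, Subgroup.zpow_mem_zpowers _ _⟩
  apply hst
  intro p hp
  refine hk p _ ?_
  have h1 := PadicInt.appr_spec (k p) (Multiplicative.toAdd x p)
  have h2 := hm p (hI.mem_toFinset.mpr hp)
  change _ - Multiplicative.toAdd (padicGenerator S ^ (m : ℤ)) p ∈ _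
  rw [toAdd_padicGenerator_zpow, ← sub_add_sub_cancel _
    (((Multiplicative.toAdd x p).appr (k p) : ℕ) : ℤ_[(p.1 : ℕ)])]
  refine add_mem h1 (Ideal.mem_span_singleton.mpr ?_)
  have h3 := (Nat.modEq_iff_dvd.mp h2)
  have h4 := (Int.castRingHom ℤ_[(p.1 : ℕ)]).map_dvd h3
  simpa using h4

theorem isOpen_setOf_pow_dvd (S : Set Nat.Primes) (p : S) (k : ℕ) :
    IsOpen {x : padicProduct S | ((p.1 : ℕ) : ℤ_[(p.1 : ℕ)]) ^ k ∣ Multiplicative.toAdd x p} := by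
  have h1 : {x : padicProduct S | ((p.1 : ℕ) : ℤ_[(p.1 : ℕ)]) ^ k ∣ Multiplicative.toAdd x p} =
      (fun x : padicProduct S => Multiplicative.toAdd x p) ⁻¹'
        Metric.closedBall 0 ((p.1 : ℝ) ^ (-k : ℤ)) := by
    ext x
    simp only [Set.mem_ofPred_eq, Set.mem_preimage, mem_closedBall_zero_iff]
    rw [← Ideal.mem_span_singleton]
    exact (PadicInt.norm_le_pow_iff_mem_span_pow _ _).symm
  rw [h1]
  refine (IsUltrametricDist.isOpen_closedBall _ (zpow_ne_zero _ ?_)).preimage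
    ((continuous_apply p).comp continuous_toAdd)
  exact_mod_cast p.1.2.ne_zero

theorem PadicInt.eq_zero_of_forall_pow_dvd {p : ℕ} [Fact p.Prime] {x : ℤ_[p]}
    (h : ∀ k : ℕ, (p : ℤ_[p]) ^ k ∣ x) : x = 0 := by
  by_contra hx
  obtain ⟨k, hk⟩ := PadicInt.exists_pow_neg_lt p (norm_pos_iff.mpr hx)
  exact hk.not_ge ((PadicInt.norm_le_pow_iff_mem_span_pow _ _).mpr
    (Ideal.mem_span_singleton.mpr (h k)))

/-- A continuous homomorphism from a compact group to a Hausdorff group whose image contains a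
dense subset is surjective. -/
theorem surjective_of_dense_zpowers {H G : Type*} [Group H] [TopologicalSpace H] [CompactSpace H]
    [Group G] [TopologicalSpace G] [T2Space G] (f : H →* G) (hf : Continuous f) {g : G}
    (hg : Dense (Subgroup.zpowers g : Set G)) (hgf : g ∈ f.range) : Function.Surjective f := by
  have h1 : closure (Set.range f) = Set.range f := (isCompact_range hf).isClosed.closure_eq
  have h2 : (Subgroup.zpowers g : Set G) ⊆ Set.range f := by
    rw [← MonoidHom.coe_range]
    exact Subgroup.zpowers_le.mpr hgf
  rw [← Set.range_eq_univ, ← h1]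
  exact (hg.mono h2).closure_eq

/-- A torsion-free procyclic profinite group is a product of groups `ℤ_p` for distinct `p`. -/
theorem exists_continuousMulEquiv_padicProduct {G : Type*} [CommGroup G] [TopologicalSpace G]
    [IsTopologicalGroup G] [CompactSpace G] [TotallyDisconnectedSpace G] [T2Space G] {g : G}
    (hg : Dense (Subgroup.zpowers g : Set G)) (htf : ∀ x : G, IsOfFinOrder x → x = 1) :
    ∃ S : Set Nat.Primes, Nonempty (G ≃ₜ* padicProduct S) := by
  let S : Set Nat.Primes :=
    {p | ∀ k : ℕ, ∃ U : Subgroup G, IsOpen (U : Set G) ∧ (p : ℕ) ^ k ∣ U.index}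
  refine ⟨S, ?_⟩
  let Γ : Subgroup (G × padicProduct S) :=
    (Subgroup.zpowers (g, padicGenerator S)).topologicalClosure
  have hmem : (g, padicGenerator S) ∈ Γ :=
    Subgroup.le_topologicalClosure _ (Subgroup.mem_zpowers _)
  have hcompact : CompactSpace Γ :=
    isCompact_iff_compactSpace.mp (Subgroup.isClosed_topologicalClosure _).isCompact
  have happrox {x : G × padicProduct S} (hx : x ∈ Γ) {W : Set (G × padicProduct S)}
      (hW : IsOpen W) (hxW : x ∈ W) : ∃ m : ℤ, (g ^ m, padicGenerator S ^ m) ∈ W := by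
    have hx' : x ∈ closure (Subgroup.zpowers (g, padicGenerator S) : Set _) := hx
    obtain ⟨y, hyW, hy⟩ := mem_closure_iff.mp hx' W hW hxW
    obtain ⟨m, rfl⟩ := Subgroup.mem_zpowers_iff.mp hy
    exact ⟨m, hyW⟩
  let f₁ : Γ →* G := (MonoidHom.fst _ _).comp Γ.subtype
  let f₂ : Γ →* padicProduct S := (MonoidHom.snd _ _).comp Γ.subtype
  have hf₁ : Continuous f₁ := continuous_fst.comp continuous_subtype_val
  have hf₂ : Continuous f₂ := continuous_snd.comp continuous_subtype_val
  have hs₁ : Function.Surjective f₁ :=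
    surjective_of_dense_zpowers f₁ hf₁ hg ⟨⟨_, hmem⟩, rfl⟩
  have hs₂ : Function.Surjective f₂ :=
    surjective_of_dense_zpowers f₂ hf₂ (dense_zpowers_padicGenerator S) ⟨⟨_, hmem⟩, rfl⟩
  -- If `(g ^ m, m)` is close to `(1, z)`, then `m` is divisible by an index that is a multiple of
  -- `p ^ k`, and `m` agrees with `z` at `p` modulo `p ^ k`.
  have hi₁ : Function.Injective f₁ := by
    rw [injective_iff_map_eq_one]
    rintro ⟨⟨x, z⟩, hxz⟩ (rfl : x = 1)
    suffices h : z = 1 by simp [h]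
    refine Multiplicative.toAdd.injective (funext fun p => ?_)
    change Multiplicative.toAdd z p = 0
    refine PadicInt.eq_zero_of_forall_pow_dvd fun k => ?_
    obtain ⟨U, hU, hUk⟩ := p.2 k
    obtain ⟨m, hm₁, hm₂⟩ := happrox hxz (W := (U : Set G) ×ˢ {y : padicProduct S |
      ((p.1 : ℕ) : ℤ_[(p.1 : ℕ)]) ^ k ∣
        Multiplicative.toAdd z p - Multiplicative.toAdd y p})
      (hU.prod ((isOpen_setOf_pow_dvd S p k).preimage (continuous_div_left' z)))
      ⟨U.one_mem, by simp⟩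
    rw [Set.mem_ofPred_eq, toAdd_padicGenerator_zpow] at hm₂
    refine (dvd_sub_left ((PadicInt.pow_p_dvd_int_iff k m).mpr ?_)).mp hm₂
    have h1 := (zpow_mem_iff_index_dvd hg hU m).mp hm₁
    exact (by exact_mod_cast hUk : ((p.1 : ℕ) : ℤ) ^ k ∣ U.index).trans h1
  have hi₂ : Function.Injective f₂ := by
    rw [injective_iff_map_eq_one]
    rintro ⟨⟨x, z⟩, hxz⟩ (rfl : z = 1)
    suffices h : x = 1 by simp [h]
    refine eq_one_of_forall_mem_isOpen fun U hU => ?_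
    -- Closeness to `1` in these finitely many coordinates makes `m` divisible by the whole index of
    -- `U`, since every prime factor of it lies in `S`.
    let W : Set (padicProduct S) := ⋂ p ∈ {p : S | (p.1 : ℕ) ∣ U.index},
      {y : padicProduct S | ((p.1 : ℕ) : ℤ_[(p.1 : ℕ)]) ^ U.index.factorization p.1 ∣
        Multiplicative.toAdd y p}
    have hfin : {p : S | (p.1 : ℕ) ∣ U.index}.Finite := by
      refine Set.Finite.of_finite_image (f := fun p : S => (p.1 : ℕ)) ?_
        (fun p _ q _ h => Subtype.ext (Nat.Primes.coe_nat_injective h))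
      refine (Finset.finite_toSet U.index.divisors).subset ?_
      rintro _ ⟨p, hp, rfl⟩
      exact Finset.mem_coe.mpr (Nat.mem_divisors.mpr ⟨hp, (index_pos_of_isOpen hU).ne'⟩)
    have hW : IsOpen W := hfin.isOpen_biInter fun p _ => isOpen_setOf_pow_dvd S p _
    obtain ⟨m, hm₁, hm₂⟩ := happrox hxz
      ((hU.preimage (continuous_const_mul x⁻¹)).prod hW) ⟨by simp [U.one_mem], by simp [W]⟩
    have hmS (p : S) (hp : (p.1 : ℕ) ∣ U.index) :
        ((p.1 : ℕ) : ℤ) ^ U.index.factorization p.1 ∣ m := by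
      have h1 := Set.mem_iInter₂.mp hm₂ p hp
      rwa [Set.mem_ofPred_eq, toAdd_padicGenerator_zpow, PadicInt.pow_p_dvd_int_iff] at h1
    have hdvd : (U.index : ℤ) ∣ m := by
      rw [← Int.natAbs_dvd_natAbs, Int.natAbs_natCast]
      rcases eq_or_ne m 0 with rfl | hm0
      · simp
      rw [← Nat.factorization_le_iff_dvd (index_pos_of_isOpen hU).ne' (Int.natAbs_ne_zero.mpr hm0)]
      intro p
      by_cases hp : p.Prime ∧ p ∣ U.index
      · have hpS : (⟨p, hp.1⟩ : Nat.Primes) ∈ S := fun k =>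
          exists_pow_dvd_index hg htf hp.1 hU hp.2 k
        have h1 := hmS ⟨⟨p, hp.1⟩, hpS⟩ hp.2
        rw [← hp.1.pow_dvd_iff_le_factorization (Int.natAbs_ne_zero.mpr hm0),
          ← Int.natCast_dvd]
        exact_mod_cast h1
      · rw [Nat.factorization_eq_zero_iff _ _ |>.mpr (by tauto)]
        exact Nat.zero_le _
    have h2 : g ^ m ∈ U := (zpow_mem_iff_index_dvd hg hU m).mpr hdvd
    have h3 : x⁻¹ ∈ U := by simpa using U.mul_mem hm₁ (U.inv_mem h2)
    simpa using U.inv_mem h3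
  let e₁ : Γ ≃* G := MulEquiv.ofBijective f₁ ⟨hi₁, hs₁⟩
  let e₂ : Γ ≃* padicProduct S := MulEquiv.ofBijective f₂ ⟨hi₂, hs₂⟩
  let c₁ : Γ ≃ₜ* G := { e₁ with
    continuous_toFun := hf₁
    continuous_invFun := (Continuous.homeoOfEquivCompactToT2 (f := e₁.toEquiv) hf₁).symm.continuous }
  let c₂ : Γ ≃ₜ* padicProduct S := { e₂ with
    continuous_toFun := hf₂
    continuous_invFun := (Continuous.homeoOfEquivCompactToT2 (f := e₂.toEquiv) hf₂).symm.continuous }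
  exact ⟨c₁.symm.trans c₂⟩

end PadicProduct

/-! ### Surjectivity of norms. -/

section NormSurjective

variable {G : Type*} [CommGroup G] [TopologicalSpace G] [IsTopologicalGroup G] {g : G}
  {C : Type*} [Field C] [MulSemiringAction G C]

/-- The powers of `g ^ U.index` are dense in `U`, and stabilizers are open. -/
theorem smul_eq_of_pow_index_smul_eq (hg : Dense (Subgroup.zpowers g : Set G))
    (hstab : ∀ x : C, IsOpen (MulAction.stabilizer G x : Set G)) {U : Subgroup G}
    (hU : IsOpen (U : Set G)) {b : C} (hb : g ^ U.index • b = b) {u : G} (hu : u ∈ U) :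
    u • b = b := by
  have hV : IsOpen ((U ⊓ MulAction.stabilizer G b : Subgroup G) : Set G) := hU.inter (hstab b)
  obtain ⟨k, hkU, hkb⟩ := exists_zpow_div_mem hg hV u
  have h1 : g ^ k ∈ U := by simpa using U.mul_mem hu hkU
  obtain ⟨q, rfl⟩ := (zpow_mem_iff_index_dvd hg hU k).mp h1
  have h2 : g ^ ((U.index : ℤ) * q) ∈ MulAction.stabilizer G b := by
    rw [zpow_mul]
    exact Subgroup.zpow_mem _ (by rw [zpow_natCast]; exact hb) q
  have h3 := Subgroup.mul_mem _ h2 (Subgroup.inv_mem _ hkb)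
  rw [mul_inv_rev, inv_inv, mul_inv_cancel_left] at h3
  exact h3

variable [CompactSpace G] [TotallyDisconnectedSpace G] [T2Space G]

/-- For a torsion-free procyclic Galois group with generator `g`, norms from finite extensions are
surjective. -/
theorem exists_partialNorm_eq [CharZero C] [IsAlgClosed C]
    (hg : Dense (Subgroup.zpowers g : Set G))
    (htf : ∀ x : G, IsOfFinOrder x → x = 1)
    (hstab : ∀ x : C, IsOpen (MulAction.stabilizer G x : Set G))
    (hgal : ∀ V : Subgroup G, IsOpen (V : Set G) → ∀ h : G,
      (∀ x : C, (∀ v ∈ V, v • x = x) → h • x = x) → h ∈ V)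
    {U : Subgroup G} (hU : IsOpen (U : Set G)) {a : C} (ha : g • a = a) (ha0 : a ≠ 0) :
    ∃ b : C, partialNorm g U.index b = a ∧ ∀ u ∈ U, u • b = b := by
  set n := U.index with hn
  have hnpos : 0 < n := index_pos_of_isOpen hU
  obtain ⟨b, hb⟩ := IsAlgClosed.exists_pow_nat_eq a hnpos
  have hb0 : b ≠ 0 := by
    rintro rfl
    exact ha0 (by rw [← hb, zero_pow hnpos.ne'])
  set U₀ := U ⊓ MulAction.stabilizer G b
  have hU₀ : IsOpen (U₀ : Set G) := hU.inter (hstab b)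
  obtain ⟨V, hV, hVU, q, hq⟩ := exists_le_mul_dvd_index hg htf hU₀ n hnpos.ne'
    (Subgroup.index_dvd_of_le inf_le_left)
  set d := U₀.index
  have hgd : g ^ d • b = b := ((pow_mem_iff_index_dvd hg hU₀ d).mpr dvd_rfl).2
  have hVpos := index_pos_of_isOpen hV
  have hVn : V.index = n * (d * q) := by rw [hq]; ring
  have hdq : 0 < d * q := Nat.pos_of_ne_zero fun h => by simp [hVn, h] at hVpos
  -- The factor `n` in the index of `V` turns `b` into `b ^ n = a`, so `partialNorm g n b * a⁻¹` has
  -- norm one under `g ^ n`.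
  have hnorm : partialNorm g V.index b = a ^ (d * q) := by
    rw [hq, mul_assoc, partialNorm_mul_of_pow_smul_eq g d (n * q) hgd, pow_mul, ← partialNorm_pow,
      hb, partialNorm_of_smul_eq g d ha, pow_mul]
  have hga : g ^ n • a = a :=
    (MulAction.stabilizer G a).pow_mem (MulAction.mem_stabilizer_iff.mpr ha) n
  let M : Submonoid C :=
    { carrier := {x | ∀ v ∈ V, v • x = x}
      one_mem' := fun v _ => smul_one v
      mul_mem' := fun {x y} hx hy v hv => by rw [smul_mul', hx v hv, hy v hv] }
  obtain ⟨e, he0, he⟩ := exists_mul_smul_eq_of_partialNorm_eq_one (g ^ n) (d * q) hdq M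
    (fun x hx => hx _ <| by rw [← pow_mul, ← hVn, pow_mem_iff_index_dvd hg hV])
    (by
      have aux : ∀ i j, i ≤ j → j < d * q → (∀ x ∈ M, (g ^ n) ^ i • x = (g ^ n) ^ j • x) →
          i = j := by
        intro i j hij hj h
        have h1 : g ^ (n * (j - i)) ∈ V := by
          refine hgal V hV _ fun x hx => ?_
          have h2 := h x hx
          rw [← Nat.sub_add_cancel hij, add_comm, pow_add, mul_smul] at h2
          rw [pow_mul]
          exact (smul_left_cancel _ h2).symm
        rw [pow_mem_iff_index_dvd hg hV, hVn] at h1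
        have h3 := Nat.eq_zero_of_dvd_of_lt (Nat.dvd_of_mul_dvd_mul_left hnpos h1) (by omega)
        omega
      intro i hi j hj h
      rcases le_total i j with hij | hij
      · exact aux i j hij hj h
      · exact (aux j i hij hi fun x hx => (h x hx).symm).symm)
    (u := partialNorm g n b * a⁻¹) (by
      rw [partialNorm_mul, partialNorm_inv, partialNorm_of_smul_eq _ _ hga,
        partialNorm_partialNorm, ← hVn, hnorm, mul_inv_cancel₀ (pow_ne_zero _ ha0)])
  -- Hilbert 90 leaves the error `g ^ n • e / e`, which telescopes as a partial norm, so it can be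
  -- absorbed into `b`.
  have htel : partialNorm g n (g • e * e⁻¹) = g ^ n • e * e⁻¹ := by
    have h1 (k : ℕ) : partialNorm g k (g • e * e⁻¹) = g ^ k • e * e⁻¹ := by
      induction k with
      | zero => simp [partialNorm, he0]
      | succ k ih =>
        have h2 : g ^ k • e ≠ 0 := (smul_ne_zero_iff_ne _).mpr he0
        rw [partialNorm_succ, ih, smul_mul', smul_inv'', ← mul_smul, ← pow_succ]
        field_simp
    exact h1 n
  have hfinal : partialNorm g n (b * (g • e * e⁻¹)) = a := by
    rw [partialNorm_mul, htel]
    have h1 : partialNorm g n b * g ^ n • e = a * e := by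
      rw [mul_right_comm, ← div_eq_mul_inv, div_eq_iff ha0] at he
      rw [he, mul_comm]
    rw [← mul_assoc, h1, mul_inv_cancel_right₀ he0]
  refine ⟨_, hfinal, fun u hu => smul_eq_of_pow_index_smul_eq hg hstab hU ?_ hu⟩
  rw [← hn]
  refine pow_smul_eq_of_smul_partialNorm_eq g n ?_ (by rw [hfinal, ha])
  exact mul_ne_zero hb0 (mul_ne_zero ((smul_ne_zero_iff_ne _).mpr he0) (inv_ne_zero he0))

end NormSurjective

/-! ### Galois groups topologically generated by one element. -/

section Galois

variable {F C : Type*} [Field F] [Field C] [Algebra F C] {s : Gal(C/F)}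

/-- Centralizers are closed: that of `g` is everything, hence so is that of every element. -/
theorem mul_comm_of_dense_zpowers {G : Type*} [Group G] [TopologicalSpace G] [IsTopologicalGroup G]
    [T2Space G] {g : G} (hg : Dense (Subgroup.zpowers g : Set G)) (x y : G) : x * y = y * x := by
  have h1 (y : G) (hy : Commute g y) (x : G) : x * y = y * x := by
    have hclosed : IsClosed {x : G | x * y = y * x} :=
      isClosed_eq (continuous_mul_const y) (continuous_const_mul y)
    have hsub : (Subgroup.zpowers g : Set G) ⊆ {x : G | x * y = y * x} := by
      intro x hx
      obtain ⟨k, rfl⟩ := Subgroup.mem_zpowers_iff.mp hx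
      exact (hy.zpow_left k).eq
    exact hclosed.closure_subset_iff.mpr hsub (hg x)
  exact h1 y (h1 g (Commute.refl g) y).symm x

theorem isOpen_stabilizer [Algebra.IsAlgebraic F C] (x : C) :
    IsOpen (MulAction.stabilizer Gal(C/F) x : Set Gal(C/F)) :=
  stabilizer_isOpen_of_isIntegral x

theorem dense_zpowers_of_fixed [IsGalois F C] (hs : ∀ x, s x = x → x ∈ Set.range (algebraMap F C)) :
    Dense (Subgroup.zpowers s : Set Gal(C/F)) := by
  let H : ClosedSubgroup Gal(C/F) :=
    ⟨(Subgroup.zpowers s).topologicalClosure, Subgroup.isClosed_topologicalClosure _⟩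
  have h1 : IntermediateField.fixedField (H : Subgroup Gal(C/F)) = ⊥ := by
    rw [eq_bot_iff]
    intro x hx
    rw [IntermediateField.mem_fixedField_iff] at hx
    exact IntermediateField.mem_bot.mpr
      (hs x (hx s (Subgroup.le_topologicalClosure _ (Subgroup.mem_zpowers s))))
  have h2 := InfiniteGalois.fixingSubgroup_fixedField H
  rw [h1, IntermediateField.fixingSubgroup_bot] at h2
  intro x
  have h3 : x ∈ (H : Subgroup Gal(C/F)) := h2 ▸ Subgroup.mem_top x
  exact h3

theorem mem_of_forall_fixed [IsGalois F C] {V : Subgroup Gal(C/F)} (hV : IsOpen (V : Set Gal(C/F)))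
    (h : Gal(C/F)) (hh : ∀ x : C, (∀ v ∈ V, v • x = x) → h • x = x) : h ∈ V := by
  have h2 := InfiniteGalois.fixingSubgroup_fixedField ⟨V, V.isClosed_of_isOpen hV⟩
  change _ = V at h2
  rw [← h2, IntermediateField.mem_fixingSubgroup_iff]
  intro x hx
  exact hh x ((IntermediateField.mem_fixedField_iff _ _).mp hx)

/-- If the absolute Galois group of `F` is topologically generated by `s` and torsion-free, then
each finite extension of `F` has an automorphism with fixed field `F` and surjective norm. -/
theorem exists_algEquiv_forall_exists_partialNorm_eq [CharZero F] [IsAlgClosed C]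
    [Algebra.IsAlgebraic F C]
    (hs : ∀ x, s x = x → x ∈ Set.range (algebraMap F C))
    (htf : ∀ x : Gal(C/F), IsOfFinOrder x → x = 1)
    (L : Type*) [Field L] [Algebra F L] [FiniteDimensional F L] :
    ∃ t : Gal(L/F), (∀ x : L, t x = x → x ∈ Set.range (algebraMap F L)) ∧
      ∀ a : F, a ≠ 0 → ∃ b : L, partialNorm t (orderOf t) b = algebraMap F L a := by
  have : CharZero C := charZero_of_injective_algebraMap (algebraMap F C).injective
  have : IsAlgClosure F C := ⟨inferInstance, inferInstance⟩
  have : IsGalois F C := IsAlgClosure.isGalois F C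
  have hdense := dense_zpowers_of_fixed hs
  let _ : CommGroup Gal(C/F) :=
    { (inferInstance : Group Gal(C/F)) with mul_comm := mul_comm_of_dense_zpowers hdense }
  let j : L →ₐ[F] C := IsAlgClosed.lift
  have hj : Function.Injective j := j.toRingHom.injective
  let e : L ≃ₐ[F] j.fieldRange := AlgEquiv.ofInjectiveField j
  have hfd : FiniteDimensional F j.fieldRange := e.toLinearEquiv.finiteDimensional
  have hU := j.fieldRange.fixingSubgroup_isOpen
  set U := j.fieldRange.fixingSubgroup with hUdef
  -- Every subgroup of an abelian group is normal.
  have hgalois : IsGalois F j.fieldRange := by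
    rw [← InfiniteGalois.normal_iff_isGalois]
    infer_instance
  let t : Gal(L/F) := (e.trans (s.restrictNormal j.fieldRange)).trans e.symm
  have ht (x : L) : j (t x) = s (j x) := by
    have h1 : ((s.restrictNormal j.fieldRange (e x) : j.fieldRange) : C) = s (j x) :=
      AlgEquiv.restrictNormal_commutes s j.fieldRange (e x)
    rw [← h1]
    exact congrArg Subtype.val (e.apply_symm_apply (s.restrictNormal j.fieldRange (e x)))
  have htpow (k : ℕ) (x : L) : j ((t ^ k) x) = (s ^ k) (j x) := by
    induction k with
    | zero => rfl
    | succ k ih => rw [pow_succ', pow_succ', AlgEquiv.mul_apply, AlgEquiv.mul_apply, ht, ih]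
  have hpow (k : ℕ) : t ^ k = 1 ↔ U.index ∣ k := by
    rw [← pow_mem_iff_index_dvd hdense hU, hUdef, IntermediateField.mem_fixingSubgroup_iff]
    constructor
    · rintro h _ ⟨x, rfl⟩
      change (s ^ k) (j x) = j x
      rw [← htpow, h]
      rfl
    · intro h
      ext x
      apply hj
      rw [htpow]
      exact h _ ⟨x, rfl⟩
  have hord : orderOf t = U.index :=
    Nat.dvd_antisymm (orderOf_dvd_of_pow_eq_one ((hpow _).mpr dvd_rfl))
      ((hpow _).mp (pow_orderOf_eq_one t))
  have hnorm (k : ℕ) (b : L) : j (partialNorm t k b) = partialNorm s k (j b) := by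
    rw [partialNorm, partialNorm, map_prod]
    exact prod_congr rfl fun i _ => htpow i b
  refine ⟨t, fun x hx => ?_, fun a ha => ?_⟩
  · obtain ⟨y, hy⟩ := hs (j x) (by rw [← ht, hx])
    exact ⟨y, hj (by rw [← hy, j.commutes])⟩
  · obtain ⟨b, hb, hbU⟩ := exists_partialNorm_eq (g := s) hdense htf isOpen_stabilizer
      (fun V hV => mem_of_forall_fixed hV) hU (a := algebraMap F C a) (s.commutes a)
      (by simpa using ha)
    have hbE : b ∈ j.fieldRange := by
      rw [← InfiniteGalois.fixedField_fixingSubgroup j.fieldRange,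
        IntermediateField.mem_fixedField_iff]
      exact hbU
    obtain ⟨c, rfl⟩ := hbE
    refine ⟨c, hj ?_⟩
    rw [hnorm, hord, j.commutes]
    exact hb

end Galois

/-! ### Central division algebras over a field with surjective norms. -/

section CentralDivision

variable {F D : Type*} [Field F] [DivisionRing D] [Algebra F D]

/-- In a central division algebra, if `∑ aᵢ d bᵢ = 0` for all `d`, with the `bᵢ` linearly
independent, then all the `aᵢ` vanish. -/
theorem eq_zero_of_forall_sum_mul_mul_eq_zero [Algebra.IsCentral F D] {ι : Type*} {b : ι → D}
    (hb : LinearIndependent F b) (t : Finset ι) (a : ι → D)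
    (h : ∀ d : D, ∑ i ∈ t, a i * d * b i = 0) : ∀ i ∈ t, a i = 0 := by
  classical
  induction t using Finset.induction_on generalizing a with
  | empty => simp
  | insert k t hk ih =>
    suffices hak : a k = 0 by
      have h' := ih a fun d => by simpa [sum_insert hk, hak] using h d
      intro i hi
      rcases mem_insert.mp hi with rfl | hi
      · exact hak
      · exact h' i hi
    by_contra hak
    have h1 (d : D) : d * b k + ∑ i ∈ t, (a k)⁻¹ * a i * d * b i = 0 := by
      have h2 := congrArg ((a k)⁻¹ * ·) (h d)
      simpa [sum_insert hk, mul_add, mul_sum, ← mul_assoc, hak] using h2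
    -- With the coefficient of `b k` normalized to `1`, the relation at `c * d` minus `c` times the
    -- relation at `d` is shorter. Hence the remaining coefficients are central, and `d = 1`
    -- contradicts independence.
    have hcomm : ∀ c : D, ∀ i ∈ t, (a k)⁻¹ * a i * c - c * ((a k)⁻¹ * a i) = 0 := fun c =>
      ih (fun i => (a k)⁻¹ * a i * c - c * ((a k)⁻¹ * a i)) fun d => by
        have h2 := h1 (c * d)
        have h3 := congrArg (c * ·) (h1 d)
        simp only [mul_add, mul_zero, mul_sum] at h3
        have h4 : ∑ i ∈ t, ((a k)⁻¹ * a i * c - c * ((a k)⁻¹ * a i)) * d * b i =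
            (c * d * b k + ∑ i ∈ t, (a k)⁻¹ * a i * (c * d) * b i) -
            (c * (d * b k) + ∑ i ∈ t, c * ((a k)⁻¹ * a i * d * b i)) := by
          rw [mul_assoc c d, add_sub_add_left_eq_sub, ← sum_sub_distrib]
          exact sum_congr rfl fun i _ => by noncomm_ring
        rw [h4, h2, h3, sub_zero]
    have hcentral : ∀ i ∈ t, ∃ r : F, (a k)⁻¹ * a i = algebraMap F D r := fun i hi =>
      (Algebra.IsCentral.mem_center_iff F).mp <| Subalgebra.mem_center_iff.mpr fun c =>
        (sub_eq_zero.mp (hcomm c i hi)).symm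
    choose! r hr using hcentral
    have h5 := linearIndependent_iff'.mp hb (insert k t) (fun i => if i = k then 1 else r i) (by
      rw [sum_insert hk, if_pos rfl, one_smul, ← h1 1, one_mul]
      congr 1
      refine sum_congr rfl fun i hi => ?_
      rw [if_neg (fun hik : i = k => hk (hik ▸ hi)), Algebra.smul_def, ← hr i hi, mul_one])
      k (mem_insert_self k t)
    simp at h5

variable {L : Type*} [Field L] [Algebra F L]

/-- The **Skolem-Noether theorem** for a generator of the automorphism group of a subfield. -/
theorem exists_ne_zero_mul_eq_mul [Algebra.IsCentral F D] [FiniteDimensional F L]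
    [Algebra.IsSeparable F L] (j : L →ₐ[F] D) (t : Gal(L/F)) :
    ∃ x : D, x ≠ 0 ∧ ∀ l : L, x * j l = j (t l) * x := by
  obtain ⟨θ, hθ⟩ := Field.exists_primitive_element F L
  set f := minpoly F θ
  have hint : IsIntegral F θ := Algebra.IsIntegral.isIntegral θ
  let ψ : L →+* Module.End F D := (Algebra.lmul F D).toRingHom.comp j.toRingHom
  let ρ : Module.End F D := LinearMap.mulRight F (j θ)
  have hcomm (l : L) : Commute (ψ l) ρ := LinearMap.ext fun d => (mul_assoc _ _ _).symm
  have hρ (k : ℕ) (d : D) : (ρ ^ k) d = d * j θ ^ k := by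
    rw [LinearMap.pow_mulRight]
    rfl
  -- Coefficients act on the left and `X` acts by right multiplication by `j θ`. Since `Φ` kills `f
  -- = (X - t θ) * q`, every value `Φ q d` intertwines `θ` with `t θ`.
  let Φ := Polynomial.eval₂RingHom' ψ ρ hcomm
  have hΦ (q : Polynomial L) (N : ℕ) (hN : q.natDegree < N) (d : D) :
      Φ q d = ∑ k ∈ range N, j (q.coeff k) * d * j θ ^ k := by
    change (Polynomial.eval₂ ψ ρ q) d = _
    rw [Polynomial.eval₂_eq_sum_range' ψ hN, LinearMap.sum_apply]
    refine sum_congr rfl fun k _ => ?_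
    change j (q.coeff k) * (ρ ^ k) d = _
    rw [hρ, mul_assoc]
  have hroot : (f.map (algebraMap F L)).IsRoot (t θ) := by
    have h1 := Polynomial.aeval_algHom_apply (t : L →ₐ[F] L) θ f
    rw [minpoly.aeval, map_zero] at h1
    rw [Polynomial.IsRoot, Polynomial.eval_map_algebraMap]
    exact h1
  obtain ⟨q, hq⟩ := Polynomial.dvd_iff_isRoot.mpr hroot
  have hfmonic : (f.map (algebraMap F L)).Monic := (minpoly.monic hint).map _
  have hqmonic : q.Monic := (Polynomial.monic_X_sub_C (t θ)).of_mul_monic_left (hq ▸ hfmonic)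
  have hdeg : q.natDegree + 1 = f.natDegree := by
    rw [← Polynomial.natDegree_map (algebraMap F L), hq,
      (Polynomial.monic_X_sub_C _).natDegree_mul hqmonic, Polynomial.natDegree_X_sub_C, add_comm]
  have hzero : Φ (f.map (algebraMap F L)) = 0 := by
    ext d
    rw [hΦ _ (f.natDegree + 1) (by rw [Polynomial.natDegree_map]; omega)]
    have h1 : Polynomial.aeval (j θ) f = 0 := by
      rw [Polynomial.aeval_algHom_apply, minpoly.aeval, map_zero]
    rw [Polynomial.aeval_eq_sum_range] at h1
    rw [LinearMap.zero_apply, ← mul_zero d, ← h1, mul_sum]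
    refine sum_congr rfl fun k _ => ?_
    rw [Polynomial.coeff_map, j.commutes, Algebra.smul_def, ← mul_assoc, Algebra.commutes]
  obtain ⟨d, hd⟩ : ∃ d, Φ q d ≠ 0 := by
    by_contra! hall
    have hli : LinearIndependent F fun i : Fin f.natDegree => j θ ^ (i : ℕ) := by
      have h1 := (linearIndependent_pow (K := F) θ).map' j.toLinearMap
        (LinearMap.ker_eq_bot.mpr j.toRingHom.injective)
      have h2 : (fun i : Fin f.natDegree => j θ ^ (i : ℕ)) =
          j.toLinearMap ∘ fun i : Fin f.natDegree => θ ^ (i : ℕ) := by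
        ext i
        simp
      rw [h2]
      exact h1
    have h3 := eq_zero_of_forall_sum_mul_mul_eq_zero hli univ (fun i => j (q.coeff i)) (fun d => by
      rw [Fin.sum_univ_eq_sum_range (fun i => j (q.coeff i) * d * j θ ^ i),
        ← hΦ q _ (by omega), hall]) ⟨q.natDegree, by omega⟩ (mem_univ _)
    simp [hqmonic.coeff_natDegree] at h3
  refine ⟨Φ q d, hd, fun l => ?_⟩
  have hxθ : Φ q d * j θ = j (t θ) * Φ q d := by
    have h1 : Φ (f.map (algebraMap F L)) d = 0 := by rw [hzero, LinearMap.zero_apply]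
    rw [hq, map_mul, map_sub] at h1
    have h2 : Φ Polynomial.X = ρ := Polynomial.eval₂_X _ _
    have h3 : Φ (Polynomial.C (t θ)) = ψ (t θ) := Polynomial.eval₂_C _ _
    rw [h2, h3] at h1
    exact sub_eq_zero.mp h1
  have hl : l ∈ Algebra.adjoin F {θ} := by
    rw [← IntermediateField.adjoin_simple_toSubalgebra_of_isAlgebraic hint.isAlgebraic, hθ]
    trivial
  induction hl using Algebra.adjoin_induction with
  | mem y hy =>
    rw [Set.mem_singleton_iff.mp hy]
    exact hxθ
  | algebraMap r => rw [t.commutes, j.commutes, Algebra.commutes]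
  | add y z _ _ hy hz => rw [map_add, map_add, map_add, mul_add, add_mul, hy, hz]
  | mul y z _ _ hy hz =>
    rw [map_mul, map_mul, map_mul, ← mul_assoc, hy, mul_assoc, hz, mul_assoc]

/-- Every finite-dimensional division algebra has a subfield that is its own centralizer. -/
theorem exists_field_self_centralizing {F : Type u} {D : Type v} [Field F] [DivisionRing D]
    [Algebra F D] [FiniteDimensional F D] :
    ∃ (L : Type v) (_ : Field L) (_ : Algebra F L) (_ : FiniteDimensional F L) (j : L →ₐ[F] D),
      ∀ c : D, (∀ l : L, c * j l = j l * c) → c ∈ j.range := by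
  let P : ℕ → Prop := fun n => ∃ S : Subalgebra F D, (∀ x ∈ S, ∀ y ∈ S, x * y = y * x) ∧
    Module.finrank F S = n
  have hP : ∃ n, n ≤ Module.finrank F D ∧ P n :=
    ⟨Module.finrank F (⊥ : Subalgebra F D), Submodule.finrank_le
      (Subalgebra.toSubmodule (⊥ : Subalgebra F D)), ⊥, by
      intro x hx y hy
      obtain ⟨r, rfl⟩ := Algebra.mem_bot.mp hx
      exact Algebra.commutes r y, rfl⟩
  classical
  obtain ⟨n, hn, hPn⟩ := hP
  -- A commutative subalgebra of maximal dimension: adjoining an element that commutes with it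
  -- cannot enlarge it.
  obtain ⟨S, hcomm, hS⟩ := Nat.findGreatest_spec hn hPn
  have hmax (T : Subalgebra F D) (hT : ∀ x ∈ T, ∀ y ∈ T, x * y = y * x) :
      Module.finrank F T ≤ Module.finrank F S := by
    rw [hS]
    exact Nat.le_findGreatest (Submodule.finrank_le (Subalgebra.toSubmodule T)) ⟨T, hT, rfl⟩
  let _ : CommRing S :=
    { (inferInstance : Ring S) with mul_comm := fun x y => Subtype.ext (hcomm x x.2 y y.2) }
  have hfield : IsField S := by
    have : IsDomain S := inferInstance
    exact Algebra.IsIntegral.isField_iff_isField (R := F) (S := S)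
      (algebraMap F S).injective |>.mp (Field.toIsField F)
  let _ : Field S := hfield.toField
  refine ⟨S, hfield.toField, inferInstance, inferInstance, S.val, fun c hc => ?_⟩
  have hT : IsMulCommutative (Algebra.adjoin F (insert c (S : Set D))) := by
    refine Algebra.isMulCommutative_adjoin F ?_
    rintro x (rfl | hx) y (rfl | hy)
    · rfl
    · exact hc ⟨y, hy⟩
    · exact (hc ⟨x, hx⟩).symm
    · exact hcomm x hx y hy
  have hle : S ≤ Algebra.adjoin F (insert c (S : Set D)) := fun x hx =>
    Algebra.subset_adjoin (Set.mem_insert_of_mem c hx)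
  have heq := Subalgebra.eq_of_le_of_finrank_le hle
    (hmax _ fun x hx y hy => congrArg Subtype.val (hT.is_comm.comm ⟨x, hx⟩ ⟨y, hy⟩))
  have hcS : c ∈ S := by
    rw [heq]
    exact Algebra.subset_adjoin (Set.mem_insert c _)
  exact ⟨⟨c, hcS⟩, rfl⟩

/-- A central division algebra over `F` is trivial if all finite extensions of `F` are cyclic with
surjective norm. -/
theorem surjective_algebraMap_of_norm {F : Type u} {D : Type v} [Field F] [CharZero F]
    [DivisionRing D] [Algebra F D] [FiniteDimensional F D] [Algebra.IsCentral F D]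
    (hF : ∀ (L : Type v) [Field L] [Algebra F L] [FiniteDimensional F L],
      ∃ t : Gal(L/F), (∀ x : L, t x = x → x ∈ Set.range (algebraMap F L)) ∧
        ∀ a : F, a ≠ 0 → ∃ b : L, partialNorm t (orderOf t) b = algebraMap F L a) :
    Function.Surjective (algebraMap F D) := by
  obtain ⟨L, _, _, _, j, hj⟩ := exists_field_self_centralizing (F := F) (D := D)
  obtain ⟨t, ht, hnorm⟩ := hF L
  set n := orderOf t with hn
  have hnpos : 0 < n := orderOf_pos t
  obtain ⟨x, hx0, hx⟩ := exists_ne_zero_mul_eq_mul j t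
  have hxpow (k : ℕ) (l : L) : x ^ k * j l = j ((t ^ k) l) * x ^ k := by
    induction k with
    | zero => simp
    | succ k ih => rw [pow_succ', pow_succ', mul_assoc, ih, ← mul_assoc, hx, mul_assoc]; rfl
  obtain ⟨c, hc⟩ := hj (x ^ n) fun l => by rw [hxpow, hn, pow_orderOf_eq_one]; rfl
  have hc : j c = x ^ n := hc
  have hj_inj : Function.Injective j := j.toRingHom.injective
  have htc : t c = c := by
    apply hj_inj
    apply mul_right_cancel₀ hx0
    rw [← hx, hc, ← pow_succ', pow_succ]
  obtain ⟨a, rfl⟩ := ht c htc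
  have ha0 : a ≠ 0 := by
    rintro rfl
    rw [map_zero, map_zero] at hc
    exact pow_ne_zero n hx0 hc.symm
  obtain ⟨b, hb⟩ := hnorm a⁻¹ (inv_ne_zero ha0)
  set y := j b * x with hy
  have hypow (k : ℕ) : y ^ k = j (partialNorm t k b) * x ^ k := by
    induction k with
    | zero => simp [partialNorm]
    | succ k ih =>
      rw [pow_succ, ih, hy, partialNorm_succ, map_mul, pow_succ, mul_assoc, ← mul_assoc (x ^ k),
        hxpow, ← AlgEquiv.smul_def]
      simp only [mul_assoc]
  have hyn : y ^ n = 1 := by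
    rw [hypow, hb, ← hc, ← map_mul, ← map_mul, inv_mul_cancel₀ ha0, map_one, map_one]
  have hy0 : y ≠ 0 := by
    intro h
    rw [h, zero_pow hnpos.ne'] at hyn
    exact zero_ne_one hyn
  have hyl (k : ℕ) (l : L) : y ^ k * j l = j ((t ^ k) l) * y ^ k := by
    rw [hypow, mul_assoc, hxpow, ← mul_assoc, ← mul_assoc, ← map_mul, ← map_mul, mul_comm]
  -- If `y ≠ 1`, then `∑ y ^ i = 0`; but the `y ^ i` are eigenvectors of right multiplication by `θ`
  -- with distinct eigenvalues `(t ^ i) θ`, hence left `L`-independent.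
  have hy1 : y = 1 := by
    by_contra hne
    have hgeom : ∑ i ∈ range n, y ^ i = 0 := by
      have h1 := Commute.geom_sum₂_mul (Commute.one_right y) n
      simp only [one_pow, mul_one, hyn, sub_self] at h1
      exact (mul_eq_zero.mp h1).resolve_right (sub_ne_zero.mpr hne)
    obtain ⟨θ, hθ⟩ := Field.exists_primitive_element F L
    let _ : Module L D := Module.compHom D j.toRingHom
    let R : Module.End L D :=
      { toFun := fun d => d * j θ
        map_add' := fun d e => add_mul d e _
        map_smul' := fun l d => mul_assoc (j l) d (j θ) }
    have hli := Module.End.eigenvectors_linearIndependent' R (fun i : Fin n => (t ^ (i : ℕ)) θ)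
      (by
        intro i k hik
        have h2 : t ^ (i : ℕ) = t ^ (k : ℕ) := by
          have h3 : Algebra.adjoin F {θ} = ⊤ := by
            rw [← IntermediateField.adjoin_simple_toSubalgebra_of_isAlgebraic
              (Algebra.IsAlgebraic.isAlgebraic θ), hθ, IntermediateField.top_toSubalgebra]
          refine AlgEquiv.coe_toAlgHom_injective (AlgHom.ext_of_adjoin_eq_top h3 fun z hz => ?_)
          rw [Set.mem_singleton_iff.mp hz]
          exact hik
        exact Fin.ext (pow_injOn_Iio_orderOf (by simpa [hn] using i.2) (by simpa [hn] using k.2) h2))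
      (fun i => y ^ (i : ℕ)) (fun i => ⟨Module.End.mem_eigenspace_iff.mpr (hyl i θ),
        pow_ne_zero _ hy0⟩)
    have h3 := Fintype.linearIndependent_iff.mp hli (fun _ => 1) (by
      simp_rw [one_smul]
      rw [Fin.sum_univ_eq_sum_range (fun i => y ^ i), hgeom]) ⟨0, hnpos⟩
    exact one_ne_zero h3
  have hL : ∀ l : L, l ∈ Set.range (algebraMap F L) := fun l => by
    refine ht l (hj_inj ?_)
    have := hyl 1 l
    rwa [hy1, pow_one, pow_one, one_mul, mul_one, eq_comm] at this
  intro d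
  obtain ⟨l, rfl⟩ := hj d fun l => by
    obtain ⟨r, rfl⟩ := hL l
    rw [j.commutes, Algebra.commutes]
  obtain ⟨r, rfl⟩ := hL l
  exact ⟨r, (j.commutes r).symm⟩

end CentralDivision

/-! ### From division algebras to Brauer classes. -/

section Brauer

open FixedFieldBrauer

theorem brauerTrivial_of_forall_surjective {F : Type v} [Field F]
    (h : ∀ (D : Type v) [DivisionRing D] [Algebra F D] [FiniteDimensional F D]
      [Algebra.IsCentral F D], Function.Surjective (algebraMap F D)) : BrauerTrivial F := by
  intro b
  induction b using Quotient.inductionOn with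
  | h A =>
    have : IsArtinianRing A := IsArtinianRing.of_finite F A
    obtain ⟨n, hn, D, _, _, hD, ⟨e⟩⟩ :=
      IsSimpleRing.exists_algEquiv_matrix_divisionRing_finite F A
    have hcentral : Algebra.IsCentral F D := by
      have hM : Algebra.IsCentral F (Matrix (Fin n) (Fin n) D) :=
        Algebra.IsCentral.of_algEquiv F A _ e
      refine ⟨fun d hd => ?_⟩
      have h1 : Matrix.scalar (Fin n) d ∈
          Subalgebra.center F (Matrix (Fin n) (Fin n) D) := by
        rw [Subalgebra.mem_center_iff]
        intro M
        exact ((Matrix.scalar_commute d (fun r => (Subalgebra.mem_center_iff.mp hd r).symm) M).symm).eq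
      obtain ⟨r, hr⟩ := (Algebra.IsCentral.mem_center_iff F).mp h1
      refine Algebra.mem_bot.mpr ⟨r, ?_⟩
      have h2 := congrFun (congrFun hr 0) 0
      simpa [Matrix.algebraMap_matrix_apply] using h2.symm
    have hbij : Function.Bijective (Algebra.ofId F D) :=
      ⟨(algebraMap F D).injective, h D⟩
    let e' : F ≃ₐ[F] D := AlgEquiv.ofBijective _ hbij
    -- The Brauer equivalence is witnessed by `M₁(A) ≃ Mₙ(F)`.
    refine Quotient.sound ⟨1, n, one_ne_zero, hn.ne, ⟨?_⟩⟩
    exact ((e.trans e'.symm.mapMatrix).mapMatrix (m := Fin 1)).trans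
      ((Matrix.compAlgEquiv (Fin 1) (Fin n) F F).trans
        (Matrix.reindexAlgEquiv F F (Equiv.uniqueProd (Fin n) (Fin 1))))

end Brauer

/-! ### The torsion case and the main theorem. -/

/-- Elements algebraic over the base field have finite orbits under automorphisms. -/
theorem exists_pow_smul_eq {F C : Type*} [Field F] [Field C] [Algebra F C]
    [Algebra.IsAlgebraic F C] (h : Gal(C/F)) (x : C) : ∃ n : ℕ, 0 < n ∧ h ^ n • x = x := by
  set f := minpoly F x
  have hf : f ≠ 0 := minpoly.ne_zero (Algebra.IsIntegral.isIntegral x)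
  have hmaps : ∀ k : ℕ, (h ^ k) x ∈ f.rootSet C := fun k => by
    rw [Polynomial.mem_rootSet_of_ne hf]
    have h1 := Polynomial.aeval_algHom_apply ((h ^ k : Gal(C/F)) : C →ₐ[F] C) x f
    rw [minpoly.aeval, map_zero] at h1
    exact h1
  obtain ⟨i, -, k, -, hne, hik⟩ := Set.infinite_univ.exists_ne_map_eq_of_mapsTo
    (f := fun k : ℕ => (h ^ k) x) (fun k _ => hmaps k) (f.rootSet_finite C)
  have aux : ∀ i k : ℕ, i < k → (h ^ i) x = (h ^ k) x → h ^ (k - i) • x = x := by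
    intro i k hlt heq
    rw [← Nat.add_sub_cancel' hlt.le, pow_add, AlgEquiv.mul_apply] at heq
    exact ((h ^ i).injective heq).symm
  rcases lt_or_gt_of_ne hne with hlt | hlt
  · exact ⟨k - i, Nat.sub_pos_of_lt hlt, aux i k hlt hik⟩
  · exact ⟨i - k, Nat.sub_pos_of_lt hlt, aux k i hlt hik.symm⟩

/-- An abelian absolute Galois group in characteristic zero with nontrivial torsion has order two. -/
theorem nonempty_continuousMulEquiv_zmod_two {F C : Type*} [Field F] [Field C] [Algebra F C]
    [CharZero C] [IsAlgClosed C] [Algebra.IsAlgebraic F C]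
    (hcomm : ∀ x y : Gal(C/F), x * y = y * x) {τ : Gal(C/F)} (hfin : IsOfFinOrder τ) (hτ : τ ≠ 1) :
    Nonempty (Gal(C/F) ≃ₜ* Multiplicative (ZMod 2)) := by
  obtain ⟨h2, i, hi, hτi⟩ := exists_smul_eq_neg_of_isOfFinOrder (C := C) hfin hτ
  have hall (h : Gal(C/F)) : h = 1 ∨ h = τ :=
    eq_one_or_eq_of_commute h2 hi hτi (hcomm τ h) (exists_pow_smul_eq h)
  have huniv : (Set.univ : Set Gal(C/F)) = {1, τ} := by
    ext h
    simpa using hall h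
  have hcard : Nat.card Gal(C/F) = 2 := by
    rw [← Set.ncard_univ, huniv, Set.ncard_pair hτ.symm]
  have : Finite Gal(C/F) := Nat.finite_of_card_ne_zero (by omega)
  have : Fact (Nat.Prime 2) := ⟨Nat.prime_two⟩
  have e : Gal(C/F) ≃* Multiplicative (ZMod 2) :=
    mulEquivOfPrimeCardEq (p := 2) hcard (by simp)
  exact ⟨{ e with
    continuous_toFun := continuous_of_discreteTopology
    continuous_invFun := continuous_of_discreteTopology }⟩

theorem mainTheorem7 {K : Type u} [Field K] [NumberField K]
    {Kbar : Type v} [Field Kbar] [Algebra K Kbar] [IsAlgClosure K Kbar]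
    (σ : Gal(Kbar/K)) :
    ((∃ S : Set Nat.Primes,
        Nonempty (Gal(Kbar/FixedFieldBrauer.fixedFieldOf σ) ≃ₜ*
          FixedFieldBrauer.padicProduct S)) ∨
      Nonempty (Gal(Kbar/FixedFieldBrauer.fixedFieldOf σ) ≃ₜ* Multiplicative (ZMod 2))) ∧
    (NumberField.IsTotallyComplex K →
      (∀ τ : Gal(Kbar/FixedFieldBrauer.fixedFieldOf σ), IsOfFinOrder τ → τ = 1) ∧
      FixedFieldBrauer.BrauerTrivial (FixedFieldBrauer.fixedFieldOf σ)) := by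
  have : IsAlgClosed Kbar := IsAlgClosure.isAlgClosed K
  have : Algebra.IsAlgebraic K Kbar := IsAlgClosure.isAlgebraic
  have : CharZero Kbar := charZero_of_injective_algebraMap (algebraMap K Kbar).injective
  have : CharZero (FixedFieldBrauer.fixedFieldOf σ) :=
    charZero_of_injective_algebraMap (algebraMap K _).injective
  have : Algebra.IsAlgebraic (FixedFieldBrauer.fixedFieldOf σ) Kbar :=
    Algebra.IsAlgebraic.tower_top (K := K) (FixedFieldBrauer.fixedFieldOf σ)
  have : IsAlgClosure (FixedFieldBrauer.fixedFieldOf σ) Kbar := ⟨inferInstance, inferInstance⟩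
  have : IsGalois (FixedFieldBrauer.fixedFieldOf σ) Kbar := IsAlgClosure.isGalois _ _
  -- `σ` itself, viewed as an automorphism over its fixed field.
  let s : Gal(Kbar/FixedFieldBrauer.fixedFieldOf σ) :=
    { σ with commutes' := fun r => (FixedFieldBrauer.mem_fixedFieldOf σ r).mp r.2 }
  have hs : ∀ x, s x = x → x ∈ Set.range (algebraMap (FixedFieldBrauer.fixedFieldOf σ) Kbar) :=
    fun x hx => ⟨⟨x, (FixedFieldBrauer.mem_fixedFieldOf σ x).mpr hx⟩, rfl⟩
  have hdense := dense_zpowers_of_fixed hs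
  have hcomm := mul_comm_of_dense_zpowers hdense
  refine ⟨?_, fun hK => ?_⟩
  · by_cases htf : ∀ τ : Gal(Kbar/FixedFieldBrauer.fixedFieldOf σ), IsOfFinOrder τ → τ = 1
    · left
      let _ : CommGroup Gal(Kbar/FixedFieldBrauer.fixedFieldOf σ) :=
        { (inferInstance : Group Gal(Kbar/FixedFieldBrauer.fixedFieldOf σ)) with mul_comm := hcomm }
      exact exists_continuousMulEquiv_padicProduct hdense htf
    · right
      push Not at htf
      obtain ⟨τ, hfin, hτ⟩ := htf
      exact nonempty_continuousMulEquiv_zmod_two hcomm hfin hτ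
  · have htf : ∀ τ : Gal(Kbar/FixedFieldBrauer.fixedFieldOf σ), IsOfFinOrder τ → τ = 1 := by
      intro τ hfin
      by_contra hτ
      obtain ⟨h2, i, hi, hτi⟩ := exists_smul_eq_neg_of_isOfFinOrder (C := Kbar) hfin hτ
      obtain ⟨φ⟩ := nonempty_ringHom_real h2 hi hτi (algebraMap K Kbar) fun x => by
        rw [IsScalarTower.algebraMap_apply K (FixedFieldBrauer.fixedFieldOf σ) Kbar]
        exact τ.commutes _
      refine NumberField.IsTotallyComplex.complexEmbedding_not_isReal
        ((algebraMap ℝ ℂ).comp φ) ?_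
      rw [NumberField.ComplexEmbedding.isReal_iff]
      ext x
      simp
    refine ⟨htf, brauerTrivial_of_forall_surjective fun D _ _ _ _ => ?_⟩
    exact surjective_algebraMap_of_norm fun L _ _ _ =>
      exists_algEquiv_forall_exists_partialNorm_eq hs htf L
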